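/- For a nonzero element $\alpha$ of a field write $[\alpha]=\alpha-\alpha^{-1}$ and $\langle\alpha\rangle=\alpha+\alpha^{-1}$. Let $Z_N(a,b,c,x,y)$ be the $N\times N$ spiral matrix defined as follows. The value $a$ is placed in the centre, that is, in row $\lfloor N/2\rfloor+1$ and column $\lfloor (N+1)/2\rfloor$. From there one follows the square spiral which goes one step right, one step up, two steps left, two steps down, three steps right, three steps up, and so on, until all $N^2$ positions are visited; with each step to the right, up, left, down, the value is multiplied by $x,b,y,c$, respectively. If the value obtained at a position is $\alpha$, then the entry of $Z_N(a,b,c,x,y)$ at this position is $[\alpha]$. Let $a,b,c,x$ be nonzero elements of a field in which $b$ and $c$ have square roots, and fix square roots $b^{1/2}$, $c^{1/2}$; half-integral powers of $b$, $c$ and $bc$ are formed with these, with $(bc)^{1/2}=b^{1/2}c^{1/2}$. Then for all integers $n\ge 1$ we have $$\det Z_{2n}(a,b,c,x,x)=(-1)^{n+1}\left[a^2b^{2n^2-2n+1}c^{2n^2-2n}x^{2n(2n-1)}\right]\prod_{k=0}^{2n-2}\left[(bc)^{k/2}x^{k+1}\right]\prod_{k=1}^{n-1}\left\langle ab^{k(k+1)}c^{k^2}x^{k(2k+1)}\right\rangle\left\langle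 ab^{(2k^2-2k+1)/2}c^{(2k^2-1)/2}x^{k(2k-1)}\right\rangle$$ and $$\det Z_{2n+1}(a,b,c,x,x)=(-1)^{n}\left[a^2(bc)^{2n^2}x^{2n(2n+1)}\right]\prod_{k=0}^{2n-1}\left[(bc)^{k/2}x^{k+1}\right]\prod_{k=1}^{n-1}\left\langle ab^{k(k+1)}c^{k^2}x^{k(2k+1)}\right\rangle\prod_{k=1}^{n}\left\langle ab^{(2k^2-2k+1)/2}c^{(2k^2-1)/2}x^{k(2k-1)}\right\rangle .$$ Moreover $\det Z_1(a,b,c,x,x)=[a]$ (the second formula for $n=0$, if the product $\prod_{k=1}^{-1}\langle\cdot\rangle$ in it is read as the reciprocal $1/\langle a\rangle$ of its $k=0$ factor). -/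

import Mathlib

/-!
Square spirals.  A cell is a pair `(row, column) : ℤ × ℤ`, rows counted downwards, and the
spiral starts at the cell `(0, 0)`.  It consists of straight sides, numbered `s = 0, 1, 2, …`,
which run right, up, left, down, right, up, … and have `1, 1, 2, 2, 3, 3, …` steps.
-/

/-- The value attached to the direction of side `s`: sides number `0, 1, 2, 3, 4, 5, …` run to the
right, up, left, down, right, up, …. -/
def spiralDir {α : Type*} (right up left down : α) (s : ℕ) : α :=
  match s % 4 with
  | 0 => right
  | 1 => up
  | 2 => left
  | _ => down

/-- The number of steps of side `s`: `1, 1, 2, 2, 3, 3, …`. -/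
def spiralLen (s : ℕ) : ℕ := s / 2 + 1

/-- The displacement caused by one step along side `s`. -/
def spiralStep (s : ℕ) : ℤ × ℤ := spiralDir (0, 1) (-1, 0) (0, -1) (1, 0) s

/-- The cell at which side `s` of the spiral starts. -/
def spiralCorner : ℕ → ℤ × ℤ
  | 0 => (0, 0)
  | s + 1 => spiralCorner s + spiralLen s • spiralStep s

/-- The cell reached after `r` steps along side `s`. -/
def spiralCell (s r : ℕ) : ℤ × ℤ := spiralCorner s + r • spiralStep s

/-- The product of the starting value `a` and of the factors `x` (for each step to the right),
`b` (up), `y` (left), `c` (down) along the spiral, up to the start of side `s`. -/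
def spiralCornerValue {K : Type*} [Field K] (a b c x y : K) : ℕ → K
  | 0 => a
  | s + 1 => spiralCornerValue a b c x y s * spiralDir x b y c s ^ spiralLen s

/-- The same product, up to the cell reached after `r` steps along side `s`. -/
def spiralStepValue {K : Type*} [Field K] (a b c x y : K) (s r : ℕ) : K :=
  spiralCornerValue a b c x y s * spiralDir x b y c s ^ r

theorem spiralCorner_eq (m : ℕ) :
    spiralCorner (4 * m) = ((m : ℤ), -(m : ℤ)) ∧
    spiralCorner (4 * m + 1) = ((m : ℤ), (m : ℤ) + 1) ∧
    spiralCorner (4 * m + 2) = (-(m : ℤ) - 1, (m : ℤ) + 1) ∧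
    spiralCorner (4 * m + 3) = (-(m : ℤ) - 1, -(m : ℤ) - 1) := by
  have key : ∀ m : ℕ, spiralCorner (4 * m) = ((m : ℤ), -(m : ℤ)) →
      spiralCorner (4 * m + 1) = ((m : ℤ), (m : ℤ) + 1) ∧
      spiralCorner (4 * m + 2) = (-(m : ℤ) - 1, (m : ℤ) + 1) ∧
      spiralCorner (4 * m + 3) = (-(m : ℤ) - 1, -(m : ℤ) - 1) ∧
      spiralCorner (4 * (m + 1)) = (((m + 1 : ℕ) : ℤ), -((m + 1 : ℕ) : ℤ)) := by
    intro m h0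
    have e0 : (4 * m) % 4 = 0 := by omega
    have e1 : (4 * m + 1) % 4 = 1 := by omega
    have e2 : (4 * m + 2) % 4 = 2 := by omega
    have e3 : (4 * m + 3) % 4 = 3 := by omega
    have l0 : (4 * m) / 2 = 2 * m := by omega
    have l1 : (4 * m + 1) / 2 = 2 * m := by omega
    have l2 : (4 * m + 2) / 2 = 2 * m + 1 := by omega
    have l3 : (4 * m + 3) / 2 = 2 * m + 1 := by omega
    have h1 : spiralCorner (4 * m + 1) = ((m : ℤ), (m : ℤ) + 1) := by
      rw [spiralCorner, h0]
      simp only [spiralStep, spiralDir, spiralLen, e0, l0]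
      ext <;> simp <;> ring
    have h2 : spiralCorner (4 * m + 2) = (-(m : ℤ) - 1, (m : ℤ) + 1) := by
      rw [spiralCorner, h1]
      simp only [spiralStep, spiralDir, spiralLen, e1, l1]
      ext <;> simp <;> ring
    have h3 : spiralCorner (4 * m + 3) = (-(m : ℤ) - 1, -(m : ℤ) - 1) := by
      rw [spiralCorner, h2]
      simp only [spiralStep, spiralDir, spiralLen, e2, l2]
      ext <;> simp <;> ring
    refine ⟨h1, h2, h3, ?_⟩
    rw [show 4 * (m + 1) = (4 * m + 3) + 1 by ring, spiralCorner, h3]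
    simp only [spiralStep, spiralDir, spiralLen, e3, l3]
    ext <;> simp <;> ring
  have h0 : spiralCorner (4 * m) = ((m : ℤ), -(m : ℤ)) := by
    induction m with
    | zero => simp [spiralCorner]
    | succ k ih => exact (key k ih).2.2.2
  exact ⟨h0, (key m h0).1, (key m h0).2.1, (key m h0).2.2.1⟩

theorem spiralCell_eq (m r : ℕ) :
    spiralCell (4 * m) r = ((m : ℤ), -(m : ℤ) + r) ∧
    spiralCell (4 * m + 1) r = ((m : ℤ) - r, (m : ℤ) + 1) ∧
    spiralCell (4 * m + 2) r = (-(m : ℤ) - 1, (m : ℤ) + 1 - r) ∧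
    spiralCell (4 * m + 3) r = (-(m : ℤ) - 1 + r, -(m : ℤ) - 1) := by
  obtain ⟨h0, h1, h2, h3⟩ := spiralCorner_eq m
  have e0 : (4 * m) % 4 = 0 := by omega
  have e1 : (4 * m + 1) % 4 = 1 := by omega
  have e2 : (4 * m + 2) % 4 = 2 := by omega
  have e3 : (4 * m + 3) % 4 = 3 := by omega
  refine ⟨?_, ?_, ?_, ?_⟩
  · rw [spiralCell, h0]; simp only [spiralStep, spiralDir, e0]; ext <;> simp
  · rw [spiralCell, h1]; simp only [spiralStep, spiralDir, e1]; ext <;> simp <;> ring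
  · rw [spiralCell, h2]; simp only [spiralStep, spiralDir, e2]; ext <;> simp <;> ring
  · rw [spiralCell, h3]; simp only [spiralStep, spiralDir, e3]; ext <;> simp

/-- The spiral visits every cell exactly once (the end of a side counts as the start of the
next one). -/
theorem spiral_existsUnique (p : ℤ × ℤ) :
    ∃! t : ℕ × ℕ, t.2 < spiralLen t.1 ∧ spiralCell t.1 t.2 = p := by
  obtain ⟨i, j⟩ := p
  have four : ∀ s : ℕ, ∃ m, s = 4 * m ∨ s = 4 * m + 1 ∨ s = 4 * m + 2 ∨ s = 4 * m + 3 :=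
    fun s => ⟨s / 4, by omega⟩
  apply existsUnique_of_exists_of_unique
  · by_cases hA : 0 ≤ i ∧ -i ≤ j ∧ j ≤ i
    · refine ⟨(4 * i.toNat, (j + i).toNat), ?_, ?_⟩
      · simp only [spiralLen]; omega
      · rw [(spiralCell_eq _ _).1]; simp only [Prod.mk.injEq]; omega
    by_cases hB : 1 ≤ j ∧ 1 - j ≤ i ∧ i ≤ j - 1
    · refine ⟨(4 * (j - 1).toNat + 1, (j - 1 - i).toNat), ?_, ?_⟩
      · simp only [spiralLen]; omega
      · rw [(spiralCell_eq _ _).2.1]; simp only [Prod.mk.injEq]; omega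
    by_cases hC : i ≤ -1 ∧ i + 1 ≤ j ∧ j ≤ -i
    · refine ⟨(4 * (-i - 1).toNat + 2, (-i - j).toNat), ?_, ?_⟩
      · simp only [spiralLen]; omega
      · rw [(spiralCell_eq _ _).2.2.1]; simp only [Prod.mk.injEq]; omega
    · refine ⟨(4 * (-j - 1).toNat + 3, (i - j).toNat), ?_, ?_⟩
      · simp only [spiralLen]; omega
      · rw [(spiralCell_eq _ _).2.2.2]; simp only [Prod.mk.injEq]; omega
  · rintro ⟨s, r⟩ ⟨s', r'⟩ ⟨h1, h2⟩ ⟨h1', h2'⟩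
    simp only [spiralLen] at h1 h1'
    obtain ⟨m, hm⟩ := four s
    obtain ⟨m', hm'⟩ := four s'
    obtain ⟨c0, c1, c2, c3⟩ := spiralCell_eq m r
    obtain ⟨d0, d1, d2, d3⟩ := spiralCell_eq m' r'
    rcases hm with rfl | rfl | rfl | rfl <;> rcases hm' with rfl | rfl | rfl | rfl <;>
      simp only [c0, c1, c2, c3, d0, d1, d2, d3, Prod.mk.injEq] at h2 h2' ⊢ <;> omega

/-- The product of `a` and the factors `x, b, y, c` along the spiral from the cell `(0, 0)` to the
cell `p`. -/
noncomputable def spiralValue {K : Type*} [Field K] (a b c x y : K) (p : ℤ × ℤ) : K :=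
  spiralStepValue a b c x y (spiral_existsUnique p).choose.1 (spiral_existsUnique p).choose.2

/-- The bracket `[α] = α - α⁻¹`. -/
def bracket {K : Type*} [Field K] (α : K) : K := α - α⁻¹

/-- The angle bracket `⟨α⟩ = α + α⁻¹`. -/
def angle {K : Type*} [Field K] (α : K) : K := α + α⁻¹

/-- The multiplicative spiral matrix `Z_N(a, b, c, x, y)`.  With rows and columns counted from `0`,
the spiral starts in row `⌊N / 2⌋`, column `⌊(N - 1) / 2⌋`. -/
noncomputable def spiralMatrix {K : Type*} [Field K] (N : ℕ) (a b c x y : K) :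
    Matrix (Fin N) (Fin N) K :=
  Matrix.of fun i j =>
    bracket (spiralValue a b c x y
      ((i : ℤ) - ((N / 2 : ℕ) : ℤ), (j : ℤ) - (((N - 1) / 2 : ℕ) : ℤ)))

/-!
Because steps to the right and to the left both multiply by `x`, every horizontal side of the spiral
consists of entries `[σ xʲ]` or `[τ x⁻ʲ]`, hence lies in the span of the two vectors `X = (xʲ)` and
`Y = (x⁻ʲ)`. In `Z_N` the first row is `τ Y - τ⁻¹ X` and the last row is `σ X - σ⁻¹ Y`, over the
full width of the matrix, so `det Z_N = [σ τ] P_N`, where `P_N` is the determinant of the matrix with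
these two rows replaced by `Y` and `X` (`det_outer_rows`). This accounts for the leading bracket of
the formulas and needs no division.

Passing from `Z_N` to `Z_{N+1}` adds one column and one row. The row of `Z_N` on the side of the new
row, extended by its entry in the new column, would still be in the span of `X` and `Y` were it not
for that one entry. Subtracting this combination leaves the row with a single entry, a difference of
two brackets, and the complementary minor is `P_N`. Hence `P_{N+1} = ± ([L] - [S]) P_N`
(`det_reduced_odd`, `det_reduced_even`), and `[u v] - [v / u] = [u] ⟨v⟩` gives one factor of each
product. Induction from `P_2 = [x]` finishes the proof.
-/

/-! ### Values along the spiral -/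

theorem spiralCornerValue_four_mul {K : Type*} [Field K] (a b c x : K) (m : ℕ) :
    spiralCornerValue a b c x x (4 * m) =
      a * x ^ (2 * m ^ 2 + m) * b ^ (m ^ 2) * c ^ (m ^ 2 + m) := by
  induction m with
  | zero => simp [spiralCornerValue]
  | succ m ih =>
    have e0 : (4 * m) % 4 = 0 := by omega
    have e1 : (4 * m + 1) % 4 = 1 := by omega
    have e2 : (4 * m + 2) % 4 = 2 := by omega
    have e3 : (4 * m + 3) % 4 = 3 := by omega
    have l0 : (4 * m) / 2 = 2 * m := by omega
    have l1 : (4 * m + 1) / 2 = 2 * m := by omega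
    have l2 : (4 * m + 2) / 2 = 2 * m + 1 := by omega
    have l3 : (4 * m + 3) / 2 = 2 * m + 1 := by omega
    rw [show 4 * (m + 1) = 4 * m + 3 + 1 by ring]
    simp only [spiralCornerValue, spiralDir, spiralLen, e0, e1, e2, e3, l0, l1, l2, l3, ih]
    ring

theorem spiralCornerValue_four_mul_add_one {K : Type*} [Field K] (a b c x : K) (m : ℕ) :
    spiralCornerValue a b c x x (4 * m + 1) =
      a * x ^ (2 * m ^ 2 + 3 * m + 1) * b ^ (m ^ 2) * c ^ (m ^ 2 + m) := by
  have e : (4 * m) % 4 = 0 := by omega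
  have l : (4 * m) / 2 = 2 * m := by omega
  rw [spiralCornerValue, spiralCornerValue_four_mul]
  simp only [spiralDir, spiralLen, e, l]
  ring

theorem spiralCornerValue_four_mul_add_two {K : Type*} [Field K] (a b c x : K) (m : ℕ) :
    spiralCornerValue a b c x x (4 * m + 2) =
      a * x ^ (2 * m ^ 2 + 3 * m + 1) * b ^ ((m + 1) ^ 2) * c ^ (m ^ 2 + m) := by
  have e : (4 * m + 1) % 4 = 1 := by omega
  have l : (4 * m + 1) / 2 = 2 * m := by omega
  rw [spiralCornerValue, spiralCornerValue_four_mul_add_one]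
  simp only [spiralDir, spiralLen, e, l]
  ring

theorem spiralCornerValue_four_mul_add_three {K : Type*} [Field K] (a b c x : K) (m : ℕ) :
    spiralCornerValue a b c x x (4 * m + 3) =
      a * x ^ (2 * m ^ 2 + 5 * m + 3) * b ^ ((m + 1) ^ 2) * c ^ (m ^ 2 + m) := by
  have e : (4 * m + 2) % 4 = 2 := by omega
  have l : (4 * m + 2) / 2 = 2 * m + 1 := by omega
  rw [spiralCornerValue, spiralCornerValue_four_mul_add_two]
  simp only [spiralDir, spiralLen, e, l]
  ring

/-- Both ends of a side are allowed: the last cell of a side is the first one of the next. -/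
theorem spiralValue_eq {K : Type*} [Field K] (a b c x y : K) {p : ℤ × ℤ} {s r : ℕ}
    (hr : r ≤ spiralLen s) (h : spiralCell s r = p) :
    spiralValue a b c x y p = spiralStepValue a b c x y s r := by
  have interior : ∀ s r : ℕ, r < spiralLen s → spiralCell s r = p →
      spiralValue a b c x y p = spiralStepValue a b c x y s r := by
    intro s r hr h
    have := (spiral_existsUnique p).unique (spiral_existsUnique p).choose_spec.1
      (y₂ := (s, r)) ⟨hr, h⟩
    rw [spiralValue, this]
  rcases hr.lt_or_eq with hr | rfl
  · exact interior s r hr h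
  · have hpos : 0 < spiralLen (s + 1) := by simp [spiralLen]
    rw [interior (s + 1) 0 hpos (by rw [← h]; simp [spiralCell, spiralCorner])]
    simp [spiralStepValue, spiralCornerValue]

theorem spiralValue_bottom {K : Type*} [Field K] (a b c : K) {x : K} (hx : x ≠ 0) (m : ℕ) (j : ℤ)
    (h1 : -(m : ℤ) ≤ j) (h2 : j ≤ m + 1) :
    spiralValue a b c x x ((m : ℤ), j) =
      a * x ^ (2 * m ^ 2 + 2 * m) * b ^ (m ^ 2) * c ^ (m ^ 2 + m) * x ^ j := by
  obtain ⟨r, rfl⟩ : ∃ r : ℕ, j = r - m := ⟨(j + m).toNat, by omega⟩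
  have e : (4 * m) % 4 = 0 := by omega
  rw [spiralValue_eq a b c x x (s := 4 * m) (r := r) (by simp only [spiralLen]; omega)
    (by rw [(spiralCell_eq m r).1, neg_add_eq_sub])]
  simp only [spiralStepValue, spiralCornerValue_four_mul, spiralDir, e]
  rw [zpow_sub₀ hx, zpow_natCast, zpow_natCast]
  field_simp
  ring

theorem spiralValue_top {K : Type*} [Field K] (a b c : K) {x : K} (hx : x ≠ 0) (m : ℕ) (j : ℤ)
    (h1 : -(m : ℤ) - 1 ≤ j) (h2 : j ≤ m + 1) :
    spiralValue a b c x x (-(m : ℤ) - 1, j) =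
      a * x ^ (2 * (m + 1) ^ 2) * b ^ ((m + 1) ^ 2) * c ^ (m ^ 2 + m) * (x ^ j)⁻¹ := by
  obtain ⟨r, rfl⟩ : ∃ r : ℕ, j = (m + 1 : ℕ) - r := ⟨(m + 1 - j).toNat, by omega⟩
  have e : (4 * m + 2) % 4 = 2 := by omega
  rw [spiralValue_eq a b c x x (s := 4 * m + 2) (r := r) (by simp only [spiralLen]; omega)
    (by rw [(spiralCell_eq m r).2.2.1]; ext <;> simp)]
  simp only [spiralStepValue, spiralCornerValue_four_mul_add_two, spiralDir, e]
  rw [zpow_sub₀ hx, zpow_natCast, zpow_natCast]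
  field_simp
  ring

/-- The cell just above the corner at the lower end of a left-hand side. -/
theorem spiralValue_left {K : Type*} [Field K] (a b c x : K) (m : ℕ) :
    spiralValue a b c x x ((m : ℤ), -(m : ℤ) - 1) =
      a * x ^ (2 * m ^ 2 + 5 * m + 3) * b ^ ((m + 1) ^ 2) * c ^ (m ^ 2 + 3 * m + 1) := by
  have e : (4 * m + 3) % 4 = 3 := by omega
  rw [spiralValue_eq a b c x x (s := 4 * m + 3) (r := 2 * m + 1)
    (by simp only [spiralLen]; omega)
    (by rw [(spiralCell_eq m _).2.2.2]; ext <;> simp; ring)]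
  simp only [spiralStepValue, spiralCornerValue_four_mul_add_three, spiralDir, e]
  ring

/-- The cell just below the corner at the upper end of a right-hand side. -/
theorem spiralValue_right {K : Type*} [Field K] (a b c x : K) (m : ℕ) :
    spiralValue a b c x x (-(m : ℤ), (m : ℤ) + 1) =
      a * x ^ (2 * m ^ 2 + 3 * m + 1) * b ^ (m ^ 2 + 2 * m) * c ^ (m ^ 2 + m) := by
  have e : (4 * m + 1) % 4 = 1 := by omega
  rw [spiralValue_eq a b c x x (s := 4 * m + 1) (r := 2 * m)
    (by simp only [spiralLen]; omega)
    (by rw [(spiralCell_eq m _).2.1]; ext <;> simp; ring)]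
  simp only [spiralStepValue, spiralCornerValue_four_mul_add_one, spiralDir, e]
  ring

/-- This identity turns the single entry left over when the matrix grows into a bracket times an
angle bracket. -/
theorem bracket_mul_sub_bracket_mul_inv {K : Type*} [Field K] (u v : K) :
    bracket (u * v) - bracket (v * u⁻¹) = bracket u * angle v := by
  simp only [bracket, angle, mul_inv, inv_inv]
  ring

/-! ### Two determinant lemmas -/

/-- The outer rows are combinations of `X` and `Y` with coefficient determinant `[s * t]`. -/
theorem det_outer_rows {K : Type*} [Field K] {N : ℕ} (M : Matrix (Fin (N + 2)) (Fin (N + 2)) K)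
    (X Y : Fin (N + 2) → K) {s t : K}
    (h0 : M 0 = t • Y - t⁻¹ • X) (h1 : M (Fin.last _) = s • X - s⁻¹ • Y) :
    M.det = bracket (s * t) * ((M.updateRow 0 Y).updateRow (Fin.last _) X).det := by
  have hne : (0 : Fin (N + 2)) ≠ Fin.last _ := by simp [Fin.ext_iff]
  have hM : M = (M.updateRow 0 (t • Y + (-t⁻¹) • X)).updateRow (Fin.last _)
      (s • X + (-s⁻¹) • Y) := by
    rw [neg_smul, neg_smul, ← sub_eq_add_neg, ← sub_eq_add_neg, ← h0, ← h1,
      Matrix.updateRow_eq_self, Matrix.updateRow_eq_self]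
  have same : ∀ Z : Fin (N + 2) → K,
      ((M.updateRow 0 Z).updateRow (Fin.last _) Z).det = 0 := fun Z =>
    Matrix.det_zero_of_row_eq hne (by
      rw [Matrix.updateRow_self, Matrix.updateRow_ne hne, Matrix.updateRow_self])
  have swap : ((M.updateRow 0 X).updateRow (Fin.last _) Y).det =
      -((M.updateRow 0 Y).updateRow (Fin.last _) X).det := by
    have h := same (X + Y)
    rw [Matrix.det_updateRow_add, Matrix.updateRow_comm _ hne, Matrix.det_updateRow_add,
      Matrix.updateRow_comm _ hne, Matrix.det_updateRow_add, ← Matrix.updateRow_comm _ hne,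
      ← Matrix.updateRow_comm _ hne, ← Matrix.updateRow_comm _ hne,
      ← Matrix.updateRow_comm _ hne, same, same] at h
    linear_combination h
  have expand : ∀ Z, ((M.updateRow 0 (t • Y + (-t⁻¹) • X)).updateRow (Fin.last _) Z).det =
      t * ((M.updateRow 0 Y).updateRow (Fin.last _) Z).det +
      (-t⁻¹) * ((M.updateRow 0 X).updateRow (Fin.last _) Z).det := by
    intro Z
    rw [Matrix.updateRow_comm _ hne, Matrix.det_updateRow_add, Matrix.det_updateRow_smul,
      Matrix.det_updateRow_smul, Matrix.updateRow_comm _ hne.symm,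
      Matrix.updateRow_comm _ hne.symm]
  conv_lhs => rw [hM]
  rw [Matrix.det_updateRow_add, Matrix.det_updateRow_smul, Matrix.det_updateRow_smul,
    expand, expand, same, same, swap, bracket, mul_inv]
  ring

/-- Row `k` can be reduced to a multiple of a unit vector by rows `p` and `q`, after which the
determinant is expanded along it. -/
theorem det_of_row_eq_add_single {K : Type*} [Field K] {N : ℕ}
    (M : Matrix (Fin (N + 1)) (Fin (N + 1)) K) {k p q : Fin (N + 1)} (l : Fin (N + 1))
    (hp : k ≠ p) (hq : k ≠ q) {s t d : K} (h : M k = s • M p + t • M q + Pi.single l d) :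
    M.det = (-1) ^ (k + l : ℕ) * d * (M.submatrix k.succAbove l.succAbove).det := by
  have h1 : M.det = (M.updateRow k (Pi.single l d)).det := by
    rw [← Matrix.det_updateRow_add_smul_self M hp (-s),
      ← Matrix.det_updateRow_add_smul_self _ hq (-t), Matrix.updateRow_ne hq.symm,
      Matrix.updateRow_self, Matrix.updateRow_idem, h]
    congr 2
    module
  rw [h1, Matrix.det_succ_row _ k, Finset.sum_eq_single l]
  · simp [Matrix.submatrix_updateRow_succAbove]
  · intro j _ hj
    simp [Pi.single_eq_of_ne hj]
  · simp

/-! ### The reduced spiral matrix -/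

/-- The spiral matrix with its first row replaced by `(x⁻ʲ)` and its last row replaced by `(xʲ)`,
where `j` is the column counted from the start of the spiral. For `N ≥ 2` this is what remains of
the spiral matrix after its first and last rows are expressed by these two vectors. -/
noncomputable def reducedSpiralMatrix {K : Type*} [Field K] (N : ℕ) (a b c x : K) :
    Matrix (Fin N) (Fin N) K :=
  Matrix.of fun i j =>
    if (i : ℕ) = 0 then (x ^ ((j : ℤ) - (((N - 1) / 2 : ℕ) : ℤ)))⁻¹
    else if (i : ℕ) = N - 1 then x ^ ((j : ℤ) - (((N - 1) / 2 : ℕ) : ℤ))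
    else spiralMatrix N a b c x x i j

theorem det_spiralMatrix_eq_reduced {K : Type*} [Field K] {N : ℕ} {a b c x s t : K}
    (h0 : ∀ j : Fin (N + 2), spiralMatrix (N + 2) a b c x x 0 j =
      bracket (t * (x ^ ((j : ℤ) - (((N + 2 - 1) / 2 : ℕ) : ℤ)))⁻¹))
    (h1 : ∀ j : Fin (N + 2), spiralMatrix (N + 2) a b c x x (Fin.last _) j =
      bracket (s * x ^ ((j : ℤ) - (((N + 2 - 1) / 2 : ℕ) : ℤ)))) :
    (spiralMatrix (N + 2) a b c x x).det =
      bracket (s * t) * (reducedSpiralMatrix (N + 2) a b c x).det := by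
  rw [det_outer_rows (spiralMatrix (N + 2) a b c x x)
    (fun j => x ^ ((j : ℤ) - (((N + 2 - 1) / 2 : ℕ) : ℤ)))
    (fun j => (x ^ ((j : ℤ) - (((N + 2 - 1) / 2 : ℕ) : ℤ)))⁻¹) (s := s) (t := t)]
  · congr 2
    ext i j
    by_cases hl : i = Fin.last _
    · subst hl
      simp [reducedSpiralMatrix]
    · rw [Matrix.updateRow_ne hl]
      have hl' : (i : ℕ) ≠ N + 1 := fun h => hl (Fin.ext h)
      by_cases h : i = 0
      · subst h
        simp [reducedSpiralMatrix]
      · rw [Matrix.updateRow_ne h]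
        have h' : (i : ℕ) ≠ 0 := fun h' => h (Fin.ext h')
        simp only [reducedSpiralMatrix, Matrix.of_apply, h', if_false]
        rw [if_neg (by omega)]
  · ext j
    simp only [h0, bracket, mul_inv, inv_inv, Pi.sub_apply, Pi.smul_apply, smul_eq_mul]
  · ext j
    simp only [h1, bracket, mul_inv, Pi.sub_apply, Pi.smul_apply, smul_eq_mul]

theorem det_spiralMatrix_even {K : Type*} [Field K] {a b c x : K} (hx : x ≠ 0) (m : ℕ) :
    (spiralMatrix (2 * m + 2) a b c x x).det =
      bracket ((a * x ^ (2 * m ^ 2 + 2 * m) * b ^ (m ^ 2) * c ^ (m ^ 2 + m)) *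
        (a * x ^ (2 * (m + 1) ^ 2) * b ^ ((m + 1) ^ 2) * c ^ (m ^ 2 + m))) *
      (reducedSpiralMatrix (2 * m + 2) a b c x).det := by
  have e1 : (2 * m + 2) / 2 = m + 1 := by omega
  have e2 : (2 * m + 2 - 1) / 2 = m := by omega
  refine det_spiralMatrix_eq_reduced ?_ ?_ <;> intro j <;>
    simp only [spiralMatrix, Matrix.of_apply, e1, e2]
  · rw [← spiralValue_top a b c hx m _ (by omega) (by omega)]
    congr 3
    push_cast; simp; ring
  · rw [← spiralValue_bottom a b c hx m _ (by omega) (by omega)]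
    congr 3
    push_cast [Fin.val_last]; ring

theorem det_spiralMatrix_odd {K : Type*} [Field K] {a b c x : K} (hx : x ≠ 0) (m : ℕ) :
    (spiralMatrix (2 * m + 3) a b c x x).det =
      bracket ((a * x ^ (2 * (m + 1) ^ 2 + 2 * (m + 1)) * b ^ ((m + 1) ^ 2) *
          c ^ ((m + 1) ^ 2 + (m + 1))) *
        (a * x ^ (2 * (m + 1) ^ 2) * b ^ ((m + 1) ^ 2) * c ^ (m ^ 2 + m))) *
      (reducedSpiralMatrix (2 * m + 3) a b c x).det := by
  have e1 : (2 * m + 1 + 2) / 2 = m + 1 := by omega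
  have e2 : (2 * m + 1 + 2 - 1) / 2 = m + 1 := by omega
  refine det_spiralMatrix_eq_reduced (N := 2 * m + 1) ?_ ?_ <;>
    intro j <;> simp only [spiralMatrix, Matrix.of_apply, e1, e2]
  · rw [← spiralValue_top a b c hx m _ (by omega) (by omega)]
    congr 3
    push_cast; simp; ring
  · rw [← spiralValue_bottom a b c hx (m + 1) _ (by omega) (by omega)]
    congr 3
    push_cast [Fin.val_last]; ring

/-- The last row of the spiral matrix of size `2m + 2` and its continuation to size `2m + 3` differ
only in the new leftmost column. Subtracting that continuation, a combination of the new outer rows,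
leaves one entry; deleting its row and column gives the reduced matrix of size `2m + 2`. -/
theorem det_reduced_odd {K : Type*} [Field K] {a b c x : K} (hx : x ≠ 0) (m : ℕ) :
    (reducedSpiralMatrix (2 * m + 3) a b c x).det =
      -(bracket (spiralValue a b c x x ((m : ℤ), -(m : ℤ) - 1)) -
        bracket (a * x ^ (2 * m ^ 2 + 2 * m) * b ^ (m ^ 2) * c ^ (m ^ 2 + m) *
          x ^ (-(m : ℤ) - 1))) *
      (reducedSpiralMatrix (2 * m + 2) a b c x).det := by
  have e1 : (2 * m + 3) / 2 = m + 1 := by omega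
  have e2 : (2 * m + 3 - 1) / 2 = m + 1 := by omega
  have e3 : (2 * m + 2) / 2 = m + 1 := by omega
  have e4 : (2 * m + 2 - 1) / 2 = m := by omega
  set s := a * x ^ (2 * m ^ 2 + 2 * m) * b ^ (m ^ 2) * c ^ (m ^ 2 + m) with hs
  set d := bracket (spiralValue a b c x x ((m : ℤ), -(m : ℤ) - 1)) -
    bracket (s * x ^ (-(m : ℤ) - 1)) with hd
  let k : Fin (2 * m + 2 + 1) := ⟨2 * m + 1, by omega⟩
  have hp : k ≠ Fin.last _ := by simp [k, Fin.ext_iff]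
  have hq : k ≠ 0 := by simp [k, Fin.ext_iff]
  rw [det_of_row_eq_add_single (N := 2 * m + 2) _ (k := k) 0 hp hq (s := s) (t := -s⁻¹) (d := d)]
  · have hsub : (reducedSpiralMatrix (2 * m + 2 + 1) a b c x).submatrix k.succAbove
        (Fin.succAbove 0) = reducedSpiralMatrix (2 * m + 2) a b c x := by
      ext i j
      have hcol : (((j : ℕ) + 1 : ℕ) : ℤ) - ((m + 1 : ℕ) : ℤ) = (j : ℤ) - m := by
        push_cast; ring
      by_cases hi : (i : ℕ) < 2 * m + 1
      · have hi' : ((k.succAbove i : Fin _) : ℕ) = i := by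
          rw [Fin.succAbove_of_castSucc_lt _ _ (by simpa [k, Fin.lt_def] using hi)]; simp
        have n1 : (i : ℕ) ≠ 2 * m + 2 := by omega
        have n2 : (i : ℕ) ≠ 2 * m + 1 := by omega
        simp only [reducedSpiralMatrix, spiralMatrix, Matrix.of_apply, Matrix.submatrix_apply,
          Fin.succAbove_zero, Fin.val_succ, hi', e1, e2, e3, e4, hcol]
        simp [n1, n2]
      · have hi0 : (i : ℕ) = 2 * m + 1 := by omega
        have hi' : ((k.succAbove i : Fin _) : ℕ) = 2 * m + 2 := by
          rw [Fin.succAbove_of_le_castSucc _ _ (by simp [k, Fin.le_def, hi0])]; simp [hi0]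
        simp only [reducedSpiralMatrix, Matrix.of_apply, Matrix.submatrix_apply,
          Fin.succAbove_zero, Fin.val_succ, hi', hi0, e2, e4, hcol]
        simp
    rw [hsub]
    have : (-1 : K) ^ (2 * m + 1) = -1 := Odd.neg_one_pow ⟨m, rfl⟩
    simp [k, this]
  · ext j
    have hk : ((k : Fin (2 * m + 2 + 1)) : ℕ) = 2 * m + 1 := rfl
    simp only [reducedSpiralMatrix, spiralMatrix, Matrix.of_apply, Pi.add_apply, Pi.smul_apply,
      smul_eq_mul, hk, e1, e2, Fin.val_last]
    have hrow : ((2 * m + 1 : ℕ) : ℤ) - ((m + 1 : ℕ) : ℤ) = m := by push_cast; ring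
    rw [hrow]
    by_cases hj : j = 0
    · subst hj
      have hcol : (((0 : Fin (2 * m + 2 + 1)) : ℕ) : ℤ) - ((m + 1 : ℕ) : ℤ) = -m - 1 := by
        push_cast; simp; ring
      rw [hcol]
      simp [hd, bracket]
      ring
    · have hj' : (j : ℕ) ≠ 0 := fun h => hj (Fin.ext h)
      rw [spiralValue_bottom a b c hx m _ (by omega) (by omega), Pi.single_eq_of_ne hj]
      simp [← hs, bracket]
      ring

/-- The first row of the spiral matrix of size `2m + 3` and its continuation to size `2m + 4`
differ only in the new rightmost column; the expansion is again along the row of the one entry that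
remains. -/
theorem det_reduced_even {K : Type*} [Field K] {a b c x : K} (hx : x ≠ 0) (m : ℕ) :
    (reducedSpiralMatrix (2 * m + 4) a b c x).det =
      (bracket (spiralValue a b c x x (-((m + 1 : ℕ) : ℤ), ((m + 1 : ℕ) : ℤ) + 1)) -
        bracket (a * x ^ (2 * (m + 1) ^ 2) * b ^ ((m + 1) ^ 2) * c ^ (m ^ 2 + m) *
          (x ^ ((m : ℤ) + 2))⁻¹)) *
      (reducedSpiralMatrix (2 * m + 3) a b c x).det := by
  have e1 : (2 * m + 4) / 2 = m + 2 := by omega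
  have e2 : (2 * m + 4 - 1) / 2 = m + 1 := by omega
  have e3 : (2 * m + 3) / 2 = m + 1 := by omega
  have e4 : (2 * m + 3 - 1) / 2 = m + 1 := by omega
  set t := a * x ^ (2 * (m + 1) ^ 2) * b ^ ((m + 1) ^ 2) * c ^ (m ^ 2 + m) with ht
  set d := bracket (spiralValue a b c x x (-((m + 1 : ℕ) : ℤ), ((m + 1 : ℕ) : ℤ) + 1)) -
    bracket (t * (x ^ ((m : ℤ) + 2))⁻¹) with hd
  let k : Fin (2 * m + 3 + 1) := 1
  have hp : k ≠ 0 := by simp [k]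
  have hq : k ≠ Fin.last _ := by simp [k, Fin.ext_iff]
  rw [det_of_row_eq_add_single (N := 2 * m + 3) _ (k := k) (Fin.last _) hp hq
    (s := t) (t := -t⁻¹) (d := d)]
  · have hsub : (reducedSpiralMatrix (2 * m + 3 + 1) a b c x).submatrix k.succAbove
        (Fin.succAbove (Fin.last _)) = reducedSpiralMatrix (2 * m + 3) a b c x := by
      ext i j
      by_cases hi : (i : ℕ) = 0
      · have hi' : ((k.succAbove i : Fin _) : ℕ) = 0 := by
          rw [Fin.succAbove_of_castSucc_lt _ _ (by simp [k, Fin.lt_def, hi])]; simp [hi]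
        simp only [reducedSpiralMatrix, Matrix.of_apply, Matrix.submatrix_apply,
          Fin.succAbove_last, Fin.val_castSucc, hi', hi, e2, e4, if_true]
      · have hi' : ((k.succAbove i : Fin _) : ℕ) = i + 1 := by
          rw [Fin.succAbove_of_le_castSucc _ _ (by simp [k, Fin.le_def]; omega)]; simp
        have hrow : (((i : ℕ) + 1 : ℕ) : ℤ) - ((m + 2 : ℕ) : ℤ) = (i : ℤ) - ((m + 1 : ℕ) : ℤ) := by
          push_cast; ring
        have hlast : (i : ℕ) + 1 = 2 * m + 3 + 1 - 1 ↔ (i : ℕ) = 2 * m + 3 - 1 := by omega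
        simp only [reducedSpiralMatrix, spiralMatrix, Matrix.of_apply, Matrix.submatrix_apply,
          Fin.succAbove_last, Fin.val_castSucc, hi', hi, e1, e2, e3, e4, hrow, hlast, if_false,
          Nat.succ_ne_zero]
    rw [hsub]
    have : (-1 : K) ^ (1 + (2 * m + 3)) = 1 := Even.neg_one_pow ⟨m + 2, by ring⟩
    simp [k, this]
  · ext j
    have hk : ((k : Fin (2 * m + 3 + 1)) : ℕ) = 1 := rfl
    simp only [reducedSpiralMatrix, spiralMatrix, Matrix.of_apply, Pi.add_apply, Pi.smul_apply,
      smul_eq_mul, hk, e1, e2, Fin.val_last]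
    have hrow : ((1 : ℕ) : ℤ) - ((m + 2 : ℕ) : ℤ) = -m - 1 := by push_cast; ring
    rw [hrow]
    by_cases hj : j = Fin.last _
    · subst hj
      have hcol : (((Fin.last (2 * m + 3) : Fin (2 * m + 3 + 1)) : ℕ) : ℤ) - ((m + 1 : ℕ) : ℤ) =
          m + 2 := by
        push_cast [Fin.val_last]; ring
      have h1 : -((m + 1 : ℕ) : ℤ) = -(m : ℤ) - 1 := by push_cast; ring
      have h2 : ((m + 1 : ℕ) : ℤ) + 1 = (m : ℤ) + 2 := by push_cast; ring
      rw [hcol]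
      simp only [hd, bracket, h1, h2]
      simp
      ring
    · have hj' : (j : ℕ) ≠ 2 * m + 3 := fun h => hj (Fin.ext h)
      rw [spiralValue_top a b c hx m _ (by omega) (by omega), Pi.single_eq_of_ne hj]
      simp [← ht, bracket]
      ring

/-! ### Product formulas -/

theorem det_reduced_odd_eq_mul {K : Type*} [Field K] {a β γ x : K} (hβ : β ≠ 0) (hγ : γ ≠ 0)
    (hx : x ≠ 0) (m : ℕ) :
    (reducedSpiralMatrix (2 * m + 3) a (β ^ 2) (γ ^ 2) x).det =
      -(bracket ((β * γ) ^ (2 * m + 1) * x ^ (2 * m + 2)) *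
        angle (a * β ^ (2 * m ^ 2 + 2 * m + 1) * γ ^ (2 * m ^ 2 + 4 * m + 1) *
          x ^ ((m + 1) * (2 * m + 1)))) *
      (reducedSpiralMatrix (2 * m + 2) a (β ^ 2) (γ ^ 2) x).det := by
  rw [det_reduced_odd hx, spiralValue_left, ← bracket_mul_sub_bracket_mul_inv]
  congr 4
  · ring_nf
  · rw [zpow_sub₀ hx, zpow_neg, zpow_natCast, zpow_one]
    field_simp
    ring_nf

theorem det_reduced_even_eq_mul {K : Type*} [Field K] {a β γ x : K} (hβ : β ≠ 0) (hγ : γ ≠ 0)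
    (hx : x ≠ 0) (m : ℕ) :
    (reducedSpiralMatrix (2 * m + 4) a (β ^ 2) (γ ^ 2) x).det =
      (bracket ((β * γ) ^ (2 * m + 2) * x ^ (2 * m + 3)) *
        angle (a * (β ^ 2) ^ ((m + 1) * (m + 1 + 1)) * (γ ^ 2) ^ ((m + 1) ^ 2) *
          x ^ ((m + 1) * (2 * (m + 1) + 1)))) *
      (reducedSpiralMatrix (2 * m + 3) a (β ^ 2) (γ ^ 2) x).det := by
  rw [det_reduced_even hx, spiralValue_right, ← bracket_mul_sub_bracket_mul_inv]
  congr 3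
  · ring_nf
  · rw [zpow_add₀ hx, zpow_natCast, zpow_ofNat]
    field_simp
    ring_nf

theorem det_reduced_two {K : Type*} [Field K] (a b c x : K) :
    (reducedSpiralMatrix 2 a b c x).det = bracket x := by
  simp [Matrix.det_fin_two, reducedSpiralMatrix, bracket]

theorem det_reduced_eq_prod {K : Type*} [Field K] {a β γ x : K} (hβ : β ≠ 0) (hγ : γ ≠ 0)
    (hx : x ≠ 0) (m : ℕ) :
    (reducedSpiralMatrix (2 * m + 2) a (β ^ 2) (γ ^ 2) x).det =
      (-1) ^ m * (∏ k ∈ Finset.range (2 * m + 1), bracket ((β * γ) ^ k * x ^ (k + 1))) *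
      (∏ k ∈ Finset.range m,
        angle (a * (β ^ 2) ^ ((k + 1) * (k + 1 + 1)) * (γ ^ 2) ^ ((k + 1) ^ 2) *
          x ^ ((k + 1) * (2 * (k + 1) + 1)))) *
      ∏ k ∈ Finset.range m,
        angle (a * β ^ (2 * k ^ 2 + 2 * k + 1) * γ ^ (2 * k ^ 2 + 4 * k + 1) *
          x ^ ((k + 1) * (2 * k + 1))) := by
  induction m with
  | zero => simpa using det_reduced_two a (β ^ 2) (γ ^ 2) x
  | succ m ih =>
    rw [show 2 * (m + 1) + 2 = 2 * m + 4 by ring, show 2 * (m + 1) + 1 = 2 * m + 1 + 1 + 1 by ring,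
      det_reduced_even_eq_mul hβ hγ hx, det_reduced_odd_eq_mul hβ hγ hx, ih]
    simp only [Finset.prod_range_succ]
    ring

theorem prod_Icc_one_eq_prod_range {M : Type*} [CommMonoid M] (f : ℕ → M) (n : ℕ) :
    ∏ k ∈ Finset.Icc 1 n, f k = ∏ k ∈ Finset.range n, f (k + 1) := by
  rw [Finset.range_eq_Ico, Finset.prod_Ico_add' f 0 n 1]
  congr 1

/-- The half-integral exponents of `b` and `c` are nonnegative, so they can be taken in `ℕ`. -/
theorem angle_half_integral_eq {K : Type*} [Field K] (a β γ x : K) (k : ℕ) :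
    angle (a * β ^ (2 * ((k + 1 : ℕ) : ℤ) ^ 2 - 2 * ((k + 1 : ℕ) : ℤ) + 1) *
        γ ^ (2 * ((k + 1 : ℕ) : ℤ) ^ 2 - 1) *
        x ^ (((k + 1 : ℕ) : ℤ) * (2 * ((k + 1 : ℕ) : ℤ) - 1))) =
      angle (a * β ^ (2 * k ^ 2 + 2 * k + 1) * γ ^ (2 * k ^ 2 + 4 * k + 1) *
        x ^ ((k + 1) * (2 * k + 1))) := by
  rw [show 2 * ((k + 1 : ℕ) : ℤ) ^ 2 - 2 * ((k + 1 : ℕ) : ℤ) + 1 =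
      ((2 * k ^ 2 + 2 * k + 1 : ℕ) : ℤ) by push_cast; ring,
    show 2 * ((k + 1 : ℕ) : ℤ) ^ 2 - 1 = ((2 * k ^ 2 + 4 * k + 1 : ℕ) : ℤ) by push_cast; ring,
    show ((k + 1 : ℕ) : ℤ) * (2 * ((k + 1 : ℕ) : ℤ) - 1) = (((k + 1) * (2 * k + 1) : ℕ) : ℤ) by
      push_cast; ring,
    zpow_natCast, zpow_natCast, zpow_natCast]

theorem theorem3 {K : Type*} [Field K] (a b c x : K)
    (ha : a ≠ 0) (hb : b ≠ 0) (hc : c ≠ 0) (hx : x ≠ 0)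
    -- `β` and `γ` are the square roots used for the half-integral powers of `b` and `c`
    (β γ : K) (hβ : β ^ 2 = b) (hγ : γ ^ 2 = c) :
    (∀ n : ℕ, 1 ≤ n →
      (spiralMatrix (2 * n) a b c x x).det =
        (-1) ^ (n + 1) *
        bracket (a ^ 2 * b ^ (2 * (n : ℤ) ^ 2 - 2 * n + 1) * c ^ (2 * (n : ℤ) ^ 2 - 2 * n) *
          x ^ (2 * (n : ℤ) * (2 * n - 1))) *
        (∏ k ∈ Finset.Icc 0 (2 * n - 2), bracket ((β * γ) ^ k * x ^ (k + 1))) *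
        (∏ k ∈ Finset.Icc 1 (n - 1),
          angle (a * b ^ (k * (k + 1)) * c ^ (k ^ 2) * x ^ (k * (2 * k + 1))) *
          angle (a * β ^ (2 * (k : ℤ) ^ 2 - 2 * k + 1) * γ ^ (2 * (k : ℤ) ^ 2 - 1) *
            x ^ ((k : ℤ) * (2 * k - 1))))) ∧
    (∀ n : ℕ, 1 ≤ n →
      (spiralMatrix (2 * n + 1) a b c x x).det =
        (-1) ^ n *
        bracket (a ^ 2 * (b * c) ^ (2 * n ^ 2) * x ^ (2 * n * (2 * n + 1))) *
        (∏ k ∈ Finset.Icc 0 (2 * n - 1), bracket ((β * γ) ^ k * x ^ (k + 1))) *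
        (∏ k ∈ Finset.Icc 1 (n - 1),
          angle (a * b ^ (k * (k + 1)) * c ^ (k ^ 2) * x ^ (k * (2 * k + 1)))) *
        (∏ k ∈ Finset.Icc 1 n,
          angle (a * β ^ (2 * (k : ℤ) ^ 2 - 2 * k + 1) * γ ^ (2 * (k : ℤ) ^ 2 - 1) *
            x ^ ((k : ℤ) * (2 * k - 1))))) ∧
    -- the case `n = 0` of the odd formula, where `∏_{k=1}^{-1} ⟨…⟩` stands for `1 / ⟨a⟩`
    (spiralMatrix 1 a b c x x).det = bracket a := by
  subst hβ hγ
  have hβ0 : β ≠ 0 := fun h => hb (by simp [h])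
  have hγ0 : γ ≠ 0 := fun h => hc (by simp [h])
  refine ⟨fun n hn => ?_, fun n hn => ?_, ?_⟩
  · obtain ⟨m, rfl⟩ : ∃ m, n = m + 1 := ⟨n - 1, by omega⟩
    rw [show 2 * (m + 1) = 2 * m + 2 by ring, det_spiralMatrix_even hx,
      det_reduced_eq_prod hβ0 hγ0 hx, Finset.prod_mul_distrib, Nat.add_sub_cancel,
      prod_Icc_one_eq_prod_range, prod_Icc_one_eq_prod_range, Nat.add_sub_cancel,
      ← Nat.range_succ_eq_Icc_zero]
    simp only [angle_half_integral_eq]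
    rw [show 2 * ((m + 1 : ℕ) : ℤ) ^ 2 - 2 * ((m + 1 : ℕ) : ℤ) + 1 =
        ((2 * m ^ 2 + 2 * m + 1 : ℕ) : ℤ) by push_cast; ring,
      show 2 * ((m + 1 : ℕ) : ℤ) ^ 2 - 2 * ((m + 1 : ℕ) : ℤ) =
        ((2 * m ^ 2 + 2 * m : ℕ) : ℤ) by push_cast; ring,
      show 2 * ((m + 1 : ℕ) : ℤ) * (2 * ((m + 1 : ℕ) : ℤ) - 1) =
        ((2 * (m + 1) * (2 * m + 1) : ℕ) : ℤ) by push_cast; ring,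
      zpow_natCast, zpow_natCast, zpow_natCast]
    ring_nf
  · obtain ⟨m, rfl⟩ : ∃ m, n = m + 1 := ⟨n - 1, by omega⟩
    rw [show 2 * (m + 1) + 1 = 2 * m + 3 by ring, det_spiralMatrix_odd hx,
      det_reduced_odd_eq_mul hβ0 hγ0 hx, det_reduced_eq_prod hβ0 hγ0 hx,
      show 2 * (m + 1) - 1 = 2 * m + 1 by omega, Nat.add_sub_cancel,
      prod_Icc_one_eq_prod_range, prod_Icc_one_eq_prod_range, ← Nat.range_succ_eq_Icc_zero]
    simp only [angle_half_integral_eq, Finset.prod_range_succ]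
    ring_nf
  · have h : spiralValue a (β ^ 2) (γ ^ 2) x x (0, 0) = a := by
      simpa using spiralValue_bottom a (β ^ 2) (γ ^ 2) hx 0 0 (by simp) (by simp)
    simp [spiralMatrix, h]
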